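/- **Theorem 4.1.** Let $(X,d)$ be a complete CAT(0) space of finite flat rank, i.e. there is a bound on the $n$ for which the Euclidean space $\mathbb{R}^n$ embeds isometrically into $X$. For an isometry $f\in\mathrm{Isom}(X)$ (a distance-preserving bijection of $X$) let $|f|:=\inf_{x\in X} d(f(x),x)$ be its translation length and $\mathrm{Min}(f):=\{x\in X : d(f(x),x)=|f|\}$ its minset; $f$ is called semi-simple if $\mathrm{Min}(f)\neq\emptyset$, and elliptic if moreover $|f|=0$. Let $A$ be an abelian group and let $\varphi\colon A\to\mathrm{Isom}(X)$ be a group homomorphism such that $\varphi(a)$ is semi-simple for every $a\in A$ and $$\inf\{\,|\varphi(a)| : a\in A,\ |\varphi(a)|>0\,\}>0,$$ where $\inf\emptyset=+\infty$. If $A$ has no quotient isomorphic to $\mathbb{Z}$, then every element of $\varphi(A)$ is an elliptic isometry. -/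

import Mathlib

/-- The restriction of `α` to `[0, l]` is a geodesic joining `x` to `y`
(the values of `α` outside `[0, l]` are irrelevant). -/
def IsGeodesic {X : Type*} [MetricSpace X] (x y : X) (l : ℝ) (α : ℝ → X) : Prop :=
  0 ≤ l ∧ α 0 = x ∧ α l = y ∧
    ∀ t ∈ Set.Icc 0 l, ∀ t' ∈ Set.Icc 0 l, dist (α t) (α t') = |t - t'|

/-- `S` is a geodesic segment from `x` to `y`: the image of a geodesic joining them. -/
def IsGeodesicSegment {X : Type*} [MetricSpace X] (x y : X) (S : Set X) : Prop :=
  ∃ (l : ℝ) (α : ℝ → X), IsGeodesic x y l α ∧ S = α '' Set.Icc 0 l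

/-- Every two points are joined by a geodesic. -/
def IsGeodesicSpace (X : Type*) [MetricSpace X] : Prop :=
  ∀ x y : X, ∃ (l : ℝ) (α : ℝ → X), IsGeodesic x y l α

/-- The points `p 0, p 1, p 2` and the sides `S 0, S 1, S 2` form a geodesic triangle; the side
`S i` joins `p i` to `p (i + 1)`, indices modulo `3`. -/
def IsGeodesicTriangle {X : Type*} [MetricSpace X] (p : Fin 3 → X) (S : Fin 3 → Set X) : Prop :=
  ∀ i, IsGeodesicSegment (p i) (p (i + 1)) (S i)

/-- The vertices `q` in the Euclidean plane span a comparison triangle for the triangle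
with vertices `p`. -/
def IsComparisonTriangle {X : Type*} [MetricSpace X] (p : Fin 3 → X)
    (q : Fin 3 → EuclideanSpace ℝ (Fin 2)) : Prop :=
  ∀ i j, dist (q i) (q j) = dist (p i) (p j)

/-- `x'` is a comparison point, on the side `[q i, q (i + 1)]` of the comparison triangle, for the
point `x` of the side from `p i` to `p (i + 1)`. -/
def IsComparisonPoint {X : Type*} [MetricSpace X] (p : Fin 3 → X)
    (q : Fin 3 → EuclideanSpace ℝ (Fin 2)) (i : Fin 3) (x : X)
    (x' : EuclideanSpace ℝ (Fin 2)) : Prop :=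
  x' ∈ segment ℝ (q i) (q (i + 1)) ∧ dist x' (q i) = dist x (p i)

/-- The CAT(0) inequality for the geodesic triangle with vertices `p` and sides `S`. -/
def SatisfiesCAT0Inequality {X : Type*} [MetricSpace X] (p : Fin 3 → X)
    (S : Fin 3 → Set X) : Prop :=
  ∀ q : Fin 3 → EuclideanSpace ℝ (Fin 2), IsComparisonTriangle p q →
    ∀ i j : Fin 3, ∀ x ∈ S i, ∀ y ∈ S j, ∀ x' y' : EuclideanSpace ℝ (Fin 2),
      IsComparisonPoint p q i x x' → IsComparisonPoint p q j y y' → dist x y ≤ dist x' y'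

/-- A CAT(0) space: a geodesic space all of whose geodesic triangles satisfy the CAT(0)
inequality. -/
def IsCAT0 (X : Type*) [MetricSpace X] : Prop :=
  IsGeodesicSpace X ∧
    ∀ (p : Fin 3 → X) (S : Fin 3 → Set X), IsGeodesicTriangle p S → SatisfiesCAT0Inequality p S

/-- The supremum of the dimensions `n` of isometrically embedded Euclidean spaces `ℝⁿ → X`. -/
noncomputable def flatRank (X : Type*) [MetricSpace X] : ℕ∞ :=
  sSup {d : ℕ∞ | ∃ n : ℕ, d = n ∧ ∃ f : EuclideanSpace ℝ (Fin n) → X, Isometry f}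

/-- The translation length `|f|`, the infimum of the displacement function of `f`. -/
noncomputable def translationLength {X : Type*} [MetricSpace X] (f : X ≃ᵢ X) : ℝ :=
  ⨅ x : X, dist (f x) x

/-- The set of points at which the displacement function attains its infimum. -/
def minSet {X : Type*} [MetricSpace X] (f : X ≃ᵢ X) : Set X :=
  {x | dist (f x) x = translationLength f}

/-- An isometry is semi-simple if its minset is non-empty. -/
def IsSemisimpleIsometry {X : Type*} [MetricSpace X] (f : X ≃ᵢ X) : Prop :=
  (minSet f).Nonempty

/-- An isometry is elliptic if it has translation length zero and non-empty minset. -/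
def IsEllipticIsometry {X : Type*} [MetricSpace X] (f : X ≃ᵢ X) : Prop :=
  translationLength f = 0 ∧ (minSet f).Nonempty

/-- An action by isometries is semi-simple if every group element acts as a semi-simple
isometry. -/
def IsSemisimpleAction {G X : Type*} [Group G] [MetricSpace X] (φ : G →* (X ≃ᵢ X)) : Prop :=
  ∀ g : G, IsSemisimpleIsometry (φ g)

/-- The infimum of the positive translation lengths of an action, in `[-∞, ∞]`; it is `∞` if there
are none. -/
noncomputable def infPosTranslationLength {G X : Type*} [Group G] [MetricSpace X]
    (φ : G →* (X ≃ᵢ X)) : EReal :=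
  sInf {r : EReal | ∃ g : G, 0 < translationLength (φ g) ∧ r = (translationLength (φ g) : EReal)}

/-! ### Isolated subgroups, and extension of homomorphisms one element at a time. -/

section DiscreteSeminorm

universe u

variable {A : Type u} [AddCommGroup A]

/-! On commuting semi-simple isometries of a CAT(0) space, translation length is a homogeneous
seminorm: comparison of midpoints gives `2|f| ≤ |f ^ 2|`, and comparing displacements of high powers
gives subadditivity (`IsCAT0.translationLength_mul_le`). The positive infimum makes this seminorm
discrete on `A`. If it is nonzero somewhere, `exists_surjective_int_of_discrete` maps `A` onto `ℤ`,
which is excluded; so all translation lengths vanish.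

The surjection is built by extending a homomorphism from the kernel of the seminorm. Adjoining one
element costs only an infinite cyclic factor (`IsolatedModulo.exists_saturation_eq`), so the
extension is free, but the isolation constant shrinks. This suffices for countable families. For
larger ones, induct on cardinality along chains of isolated closures with the fixed constant `ε /
2`; `IsolatedModulo.exists_hull` keeps each stage generated, modulo the initial domain, by fewer
elements. -/

/-- The seminorm `p` induces on the quotient by `M`, after extension of scalars to `ℚ`, a seminorm
which is at least `ε` at each element of `A` outside `M`. -/
def IsolatedModulo (p : AddGroupSeminorm A) (ε : ℝ) (M : Submodule ℤ A) : Prop :=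
  ∀ (n : ℤ) (b m : A), 0 < n → m ∈ M → p (n • b - m) < n * ε → b ∈ M

/-- The elements of `A` with a non-zero multiple in `M + ℤ a`. -/
def saturation (M : Submodule ℤ A) (a : A) : Submodule ℤ A where
  carrier := {b | ∃ n k : ℤ, 0 < n ∧ n • b - k • a ∈ M}
  zero_mem' := ⟨1, 0, one_pos, by simp⟩
  add_mem' := by
    rintro b b' ⟨n, k, hn, h⟩ ⟨n', k', hn', h'⟩
    refine ⟨n * n', n' * k + n * k', mul_pos hn hn', ?_⟩
    have := M.add_mem (M.smul_mem n' h) (M.smul_mem n h')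
    convert this using 1
    module
  smul_mem' := by
    rintro c b ⟨n, k, hn, h⟩
    refine ⟨n, c * k, hn, ?_⟩
    convert M.smul_mem c h using 1
    module

theorem le_saturation (M : Submodule ℤ A) (a : A) : M ≤ saturation M a :=
  fun b hb => ⟨1, 0, one_pos, by simpa using hb⟩

theorem mem_saturation_self (M : Submodule ℤ A) (a : A) : a ∈ saturation M a :=
  ⟨1, 1, one_pos, by simp⟩

variable {p : AddGroupSeminorm A} {ε : ℝ} {M : Submodule ℤ A}

theorem IsolatedModulo.mono {ε' : ℝ} (h : IsolatedModulo p ε M) (hε : ε' ≤ ε) :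
    IsolatedModulo p ε' M := fun n b m hn hm hlt =>
  h n b m hn hm (hlt.trans_le (mul_le_mul_of_nonneg_left hε (by exact_mod_cast hn.le)))

theorem IsolatedModulo.mem_of_zsmul_mem (h : IsolatedModulo p ε M) (hε : 0 < ε) {n : ℤ}
    (hn : n ≠ 0) {b : A} (hb : n • b ∈ M) : b ∈ M := by
  rcases hn.lt_or_gt with hn | hn
  · refine h (-n) b ((-n) • b) (by omega) (by rw [neg_smul]; exact M.neg_mem hb) ?_
    rw [sub_self, map_zero]
    have : (0 : ℝ) < ((-n : ℤ) : ℝ) := by exact_mod_cast (by omega : 0 < -n)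
    positivity
  · refine h n b (n • b) hn hb ?_
    rw [sub_self, map_zero]
    have : (0 : ℝ) < (n : ℝ) := by exact_mod_cast hn
    positivity

theorem IsolatedModulo.sInf {S : Set (Submodule ℤ A)} (h : ∀ K ∈ S, IsolatedModulo p ε K) :
    IsolatedModulo p ε (sInf S) := by
  intro n b m hn hm hlt
  rw [Submodule.mem_sInf] at hm ⊢
  exact fun K hK => h K hK n b m hn (hm K hK) hlt

/-- If `b` is close to a rational multiple of `a` modulo `M`, Dirichlet approximation replaces the
coefficient by `j / k` with `k ≤ K`; then `k • b - j • a` is close enough to `M` to lie in it. -/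
theorem IsolatedModulo.exists_isolatedModulo_saturation
    (hp : ∀ (n : ℤ) (a : A), p (n • a) = |(n : ℝ)| * p a)
    (h : IsolatedModulo p ε M) (hε : 0 < ε) (a : A) :
    ∃ ε' > 0, IsolatedModulo p ε' (saturation M a) := by
  -- This `K` bounds the Dirichlet error `p a / (K + 1)` by `ε / 2`; dividing by `2 * K` in `ε'`
  -- absorbs the factor `k ≤ K` in the other half.
  obtain ⟨K, hK⟩ := exists_nat_gt (2 * p a / ε)
  have hpa : 0 ≤ p a := apply_nonneg p a
  have hK0 : (0 : ℝ) < K := lt_of_le_of_lt (by positivity) hK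
  have hKpos : 0 < K := by exact_mod_cast hK0
  rw [div_lt_iff₀ hε] at hK
  refine ⟨ε / (2 * K), by positivity, ?_⟩
  rintro n b x hn ⟨n', r, hn', hx⟩ hlt
  obtain ⟨j, k, hk, hkK, hjk⟩ := Real.exists_int_int_abs_mul_sub_le ((r : ℝ) / (n * n' : ℤ)) hKpos
  have hN : (0 : ℝ) < (n * n' : ℤ) := by exact_mod_cast mul_pos hn hn'
  have hn'R : (0 : ℝ) < n' := by exact_mod_cast hn'
  have hkR : (0 : ℝ) < k := by exact_mod_cast hk
  have hkKR : (k : ℝ) ≤ K := by exact_mod_cast hkK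
  have hmem : k • b - j • a ∈ M := by
    refine h (n * n') _ (k • (n' • x - r • a)) (mul_pos hn hn') (M.smul_mem _ hx) ?_
    have e : (n * n') • (k • b - j • a) - k • (n' • x - r • a) =
        (k * n') • (n • b - x) + (k * r - j * (n * n')) • a := by module
    rw [e]
    have h1 : p ((k * n') • (n • b - x)) < (n * n' : ℤ) * (ε / 2) := by
      rw [hp]
      push_cast
      rw [abs_of_pos (by positivity)]
      calc (k : ℝ) * n' * p (n • b - x) < k * n' * (n * (ε / (2 * K))) := by gcongr
        _ ≤ K * n' * (n * (ε / (2 * K))) := by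
          have : (0 : ℝ) < n := by exact_mod_cast hn
          gcongr
        _ = n * n' * (ε / 2) := by field_simp
    have h2 : p ((k * r - j * (n * n')) • a) ≤ (n * n' : ℤ) * (ε / 2) := by
      rw [hp]
      have e2 : ((k * r - j * (n * n') : ℤ) : ℝ) =
          (n * n' : ℤ) * (k * ((r : ℝ) / (n * n' : ℤ)) - j) := by
        field_simp
        push_cast
        ring
      rw [e2, abs_mul, abs_of_pos hN, mul_assoc]
      refine mul_le_mul_of_nonneg_left ?_ hN.le
      calc _ ≤ 1 / ((K : ℝ) + 1) * p a := by gcongr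
        _ ≤ ε / 2 := by
          rw [div_mul_eq_mul_div, one_mul, div_le_div_iff₀ (by positivity) two_pos]
          linarith
    calc _ ≤ _ := map_add_le_add p _ _
      _ < (n * n' : ℤ) * (ε / 2) + (n * n' : ℤ) * (ε / 2) := add_lt_add_of_lt_of_le h1 h2
      _ = _ := by ring
  exact ⟨k, j, hk, hmem⟩

/-- The saturation of `M + ℤ a` is an extension of `M` by an infinite cyclic group. -/
theorem IsolatedModulo.exists_saturation_eq (hp : ∀ (n : ℤ) (a : A), p (n • a) = |(n : ℝ)| * p a)
    (h : IsolatedModulo p ε M) (hε : 0 < ε) {a : A} (ha : a ∉ M) :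
    ∃ c, (∀ k : ℤ, k • c ∈ M → k = 0) ∧ saturation M a = M ⊔ Submodule.span ℤ {c} := by
  have ha0 : ∀ k : ℤ, k • a ∈ M → k = 0 := fun k hk => by
    by_contra h0
    exact ha (h.mem_of_zsmul_mem hε h0 hk)
  have hpa : 0 ≤ p a := apply_nonneg p a
  -- `G` consists of the coefficients of `a` occurring in the saturation modulo `M`. Isolation makes
  -- it discrete, hence cyclic, and `c` realizes a generator.
  let G : AddSubgroup ℝ :=
    { carrier := {r | ∃ b, ∃ n k : ℤ, 0 < n ∧ n • b - k • a ∈ M ∧ r * n = k}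
      zero_mem' := ⟨0, 1, 0, one_pos, by simp, by simp⟩
      add_mem' := by
        rintro r r' ⟨b, n, k, hn, hb, hr⟩ ⟨b', n', k', hn', hb', hr'⟩
        refine ⟨b + b', n * n', n' * k + n * k', mul_pos hn hn', ?_, ?_⟩
        · convert M.add_mem (M.smul_mem n' hb) (M.smul_mem n hb') using 1
          module
        · push_cast
          rw [← hr, ← hr']
          ring
      neg_mem' := by
        rintro r ⟨b, n, k, hn, hb, hr⟩
        refine ⟨-b, n, -k, hn, ?_, by push_cast; rw [← hr]; ring⟩
        convert M.neg_mem hb using 1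
        module }
  have hG : Disjoint (G : Set ℝ) (Set.Ioo 0 (ε / (p a + 1))) := by
    rw [Set.disjoint_left]
    rintro r ⟨b, n, k, hn, hb, hr⟩ ⟨hr0, hr1⟩
    have hnR : (0 : ℝ) < n := by exact_mod_cast hn
    have hbM : b ∈ M := by
      refine h n b _ hn hb ?_
      rw [sub_sub_cancel, hp, ← hr, abs_of_pos (by positivity)]
      rw [lt_div_iff₀ (by positivity)] at hr1
      nlinarith
    have : k • a ∈ M := by
      have := M.sub_mem (M.smul_mem n hbM) hb
      rwa [sub_sub_cancel] at this
    rw [ha0 k this] at hr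
    have : 0 < r * n := by positivity
    simp [hr] at this
  obtain ⟨g, hg⟩ := AddSubgroup.cyclic_of_isolated_zero (by positivity) hG
  obtain ⟨c, n₀, k₀, hn₀, hc, hgk⟩ : g ∈ G := hg ▸ AddSubgroup.subset_closure rfl
  have hk₀ : k₀ ≠ 0 := by
    rintro rfl
    have hg0 : g = 0 := by simpa [hn₀.ne'] using hgk
    have h1 : (1 : ℝ) ∈ G := ⟨a, 1, 1, one_pos, by simp, by simp⟩
    rw [hg, hg0, AddSubgroup.mem_closure_singleton] at h1
    simp at h1
  refine ⟨c, fun k hk => ?_, le_antisymm ?_ (sup_le (le_saturation M a) ?_)⟩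
  · have h1 : (k * k₀) • a ∈ M := by
      convert M.sub_mem (M.smul_mem n₀ hk) (M.smul_mem k hc) using 1
      module
    exact (mul_eq_zero.1 (ha0 _ h1)).resolve_right hk₀
  · rintro b ⟨n, k, hn, hb⟩
    have hnR : (n : ℝ) ≠ 0 := by exact_mod_cast hn.ne'
    have hr : (k : ℝ) / n ∈ G := ⟨b, n, k, hn, hb, by field_simp⟩
    rw [hg, AddSubgroup.mem_closure_singleton] at hr
    obtain ⟨j, hj⟩ := hr
    have e : k * n₀ = n * j * k₀ := by
      have : (k : ℝ) * n₀ = n * j * k₀ := by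
        rw [← hgk]
        rw [eq_div_iff hnR, zsmul_eq_mul] at hj
        rw [← hj]
        ring
      exact_mod_cast this
    have hbc : b - j • c ∈ M := by
      refine h.mem_of_zsmul_mem hε (mul_pos hn hn₀).ne' ?_
      have e' : (n * n₀) • (b - j • c) =
          n₀ • (n • b - k • a) - (n * j) • (n₀ • c - k₀ • a) + (k * n₀ - n * j * k₀) • a := by
        module
      rw [e', e, sub_self, zero_smul, add_zero]
      exact M.sub_mem (M.smul_mem _ hb) (M.smul_mem _ hc)
    rw [Submodule.mem_sup]
    exact ⟨_, hbc, j • c, Submodule.smul_mem _ _ (Submodule.mem_span_singleton_self c), by simp⟩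
  · rw [Submodule.span_singleton_le_iff_mem]
    exact ⟨n₀, k₀, hn₀, hc⟩

/-- Extension of a partially defined homomorphism to an additional element. -/
theorem IsolatedModulo.exists_extension (hp : ∀ (n : ℤ) (a : A), p (n • a) = |(n : ℝ)| * p a)
    {f : A →ₗ.[ℤ] ℤ} (h : IsolatedModulo p ε f.domain) (hε : 0 < ε) {a : A} (ha : a ∉ f.domain)
    (y : ℤ) :
    ∃ g ≥ f, a ∈ g.domain ∧ (∃ x, g x = y) ∧ ∃ ε' > 0, IsolatedModulo p ε' g.domain := by
  obtain ⟨c, hc, hcs⟩ := h.exists_saturation_eq hp hε ha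
  have H : ∀ k : ℤ, k • c = 0 → k • y = 0 := fun k hk => by
    rw [hc k (hk ▸ f.domain.zero_mem), zero_smul]
  let s : A →ₗ.[ℤ] ℤ := LinearPMap.mkSpanSingleton' c y H
  have hs : Disjoint f.domain s.domain := by
    rw [Submodule.disjoint_def]
    intro x hx hxs
    obtain ⟨k, rfl⟩ := Submodule.mem_span_singleton.1 hxs
    rw [hc k hx, zero_smul]
  let g := f.sup s (LinearPMap.sup_h_of_disjoint f s hs)
  have hg : g.domain = saturation f.domain a := hcs.symm
  have hsg : s ≤ g := LinearPMap.right_le_sup f s _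
  refine ⟨g, LinearPMap.left_le_sup f s _, hg ▸ mem_saturation_self _ _, ?_,
    hg ▸ h.exists_isolatedModulo_saturation hp hε a⟩
  have hcm : c ∈ s.domain := Submodule.mem_span_singleton_self c
  refine ⟨⟨c, hsg.1 hcm⟩, ?_⟩
  rw [← hsg.2 (x := ⟨c, hcm⟩) rfl]
  exact LinearPMap.mkSpanSingleton'_apply_self c y H hcm

theorem IsolatedModulo.sSup_domain {c : Set (A →ₗ.[ℤ] ℤ)} (hne : c.Nonempty)
    (hc : DirectedOn (· ≤ ·) c) (h : ∀ g ∈ c, IsolatedModulo p ε g.domain) :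
    IsolatedModulo p ε (LinearPMap.sSup c hc).domain := by
  intro n b m hn hm hlt
  rw [LinearPMap.mem_domain_sSup_iff hne] at hm ⊢
  obtain ⟨g, hg, hm⟩ := hm
  exact ⟨g, hg, h g hg n b m hn hm hlt⟩

/-- Extension of a partially defined homomorphism to countably many elements. -/
theorem IsolatedModulo.exists_extension_nat
    (hp : ∀ (n : ℤ) (a : A), p (n • a) = |(n : ℝ)| * p a)
    {f : A →ₗ.[ℤ] ℤ} (h : IsolatedModulo p ε f.domain) (hε : 0 < ε) (e : ℕ → A) :
    ∃ g ≥ f, ∀ i, e i ∈ g.domain := by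
  let S := {g : A →ₗ.[ℤ] ℤ // ∃ ε' > 0, IsolatedModulo p ε' g.domain}
  have step : ∀ (g : S) (a : A), ∃ g' : S, g.1 ≤ g'.1 ∧ a ∈ g'.1.domain := by
    rintro ⟨g, ε', hε', hg⟩ a
    by_cases ha : a ∈ g.domain
    · exact ⟨⟨g, ε', hε', hg⟩, le_rfl, ha⟩
    · obtain ⟨g', hle, ha', -, hg'⟩ := hg.exists_extension hp hε' ha 0
      exact ⟨⟨g', hg'⟩, hle, ha'⟩
  choose F hF₁ hF₂ using step
  let G : ℕ → S := fun n => Nat.rec ⟨f, ε, hε, h⟩ (fun i g => F g (e i)) n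
  have hG : Monotone fun n => (G n).1 := monotone_nat_of_le_succ fun n => hF₁ (G n) (e n)
  have hd : DirectedOn (· ≤ ·) (Set.range fun n => (G n).1) :=
    directedOn_range.2 hG.directed_le
  refine ⟨LinearPMap.sSup _ hd, LinearPMap.le_sSup hd ⟨0, rfl⟩, fun i => ?_⟩
  exact (LinearPMap.le_sSup hd ⟨i + 1, rfl⟩ : (G (i + 1)).1 ≤ _).1 (hF₂ (G i) (e i))

end DiscreteSeminorm

/-! ### Extension to families of arbitrary cardinality. -/

section Extension

universe u

open Cardinal

variable {A : Type u} [AddCommGroup A] {p : AddGroupSeminorm A} {ε : ℝ} {M : Submodule ℤ A}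

/-- A family of elements lies in an isolated subgroup which, modulo `M`, is at most as large as the
family, up to countable factors. -/
theorem IsolatedModulo.exists_hull (h : IsolatedModulo p ε M) {ι : Type u} (e : ι → A) :
    ∃ (K : Submodule ℤ A) (W : Type u) (w : W → A), M ≤ K ∧ (∀ i, e i ∈ K) ∧
      IsolatedModulo p (ε / 2) K ∧ #W ≤ max #ι ℵ₀ ∧ ∀ b ∈ K, ∃ i, b - w i ∈ M := by
  classical
  -- Two elements `ε / 2`-near the same `x / n` modulo `M` differ by an element of `M`, so one
  -- choice `c n x` represents them all. Closing under subtraction and these countably many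
  -- operations gives `K`.
  let near : ℤ → A → A → Prop := fun n x b => ∃ m ∈ M, p (n • b - x - m) < n * (ε / 2)
  let c : ℤ → A → A := fun n x => if hx : ∃ b, near n x b then hx.choose else 0
  have hc : ∀ n x b, 0 < n → near n x b → b - c n x ∈ M := by
    intro n x b hn hb
    have hx : ∃ b, near n x b := ⟨b, hb⟩
    have hcn : near n x (c n x) := by
      simp only [c, dif_pos hx]
      exact hx.choose_spec
    obtain ⟨m, hm, hlt⟩ := hb
    obtain ⟨m', hm', hlt'⟩ := hcn
    refine h n _ (m - m') hn (M.sub_mem hm hm') ?_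
    have e1 : n • (b - c n x) - (m - m') = (n • b - x - m) - (n • c n x - x - m') := by module
    rw [e1]
    calc _ ≤ _ := map_sub_le_add p _ _
      _ < n * (ε / 2) + n * (ε / 2) := add_lt_add hlt hlt'
      _ = _ := by ring
  -- Formal terms: constants `0` and `e i`, the operations `c n`, and subtraction. The operations `c
  -- n` also get arity `Bool`, but read only the `true` branch.
  let α : Type u := Option ι ⊕ (ULift.{u} (ℤ ⊕ Unit))
  let β : α → Type := fun a => Sum.elim (fun _ => PEmpty) (fun _ => Bool) a
  have hβ : ∀ a, Finite (β a) := by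
    rintro (a | a)
    · exact inferInstanceAs (Finite PEmpty)
    · exact inferInstanceAs (Finite Bool)
  let val : (Σ a : α, β a → A) → A := fun t =>
    match t with
    | ⟨Sum.inl none, _⟩ => 0
    | ⟨Sum.inl (some i), _⟩ => e i
    | ⟨Sum.inr ⟨Sum.inl n⟩, v⟩ => c n (v true)
    | ⟨Sum.inr ⟨Sum.inr _⟩, v⟩ => v true - v false
  let w : WType β → A := WType.elim A val
  have w_zero : ∃ t, w t = 0 := ⟨WType.mk (Sum.inl none) PEmpty.elim, rfl⟩
  have w_e : ∀ i, ∃ t, w t = e i := fun i => ⟨WType.mk (Sum.inl (some i)) PEmpty.elim, rfl⟩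
  have w_c : ∀ n t, ∃ t', w t' = c n (w t) := fun n t =>
    ⟨WType.mk (Sum.inr ⟨Sum.inl n⟩) fun _ => t, rfl⟩
  have w_sub : ∀ t t', ∃ t'', w t'' = w t - w t' := fun t t' =>
    ⟨WType.mk (Sum.inr ⟨Sum.inr ()⟩) fun b : Bool => if b then t else t', rfl⟩
  let K : AddSubgroup A := AddSubgroup.ofSub {b | ∃ t, b - w t ∈ M}
    (by
      obtain ⟨t, ht⟩ := w_zero
      exact ⟨0, t, by simp [ht]⟩)
    (by
      rintro x ⟨t, ht⟩ y ⟨t', ht'⟩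
      obtain ⟨t'', h''⟩ := w_sub t t'
      refine ⟨t'', ?_⟩
      convert M.sub_mem ht ht' using 1
      rw [h'']
      module)
  refine ⟨AddSubgroup.toIntSubmodule K, ULift.{u} (WType β), fun t => w t.down, ?_, ?_, ?_, ?_, ?_⟩
  · intro b hb
    obtain ⟨t, ht⟩ := w_zero
    exact ⟨t, by simpa [ht] using hb⟩
  · intro i
    obtain ⟨t, ht⟩ := w_e i
    exact ⟨t, by simp [ht]⟩
  · rintro n b x hn ⟨t, ht⟩ hlt
    obtain ⟨t', ht'⟩ := w_c n t
    refine ⟨t', ?_⟩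
    rw [ht']
    refine hc n _ b hn ⟨x - w t, ht, ?_⟩
    convert hlt using 2
    abel
  · have h1 := WType.cardinalMk_le_max_aleph0_of_finite' (β := β)
    rw [mk_uLift]
    refine (lift_le.2 h1).trans ?_
    have h2 : #α ≤ max #ι ℵ₀ := by
      simp only [α, mk_sum, mk_option, lift_id, mk_uLift]
      refine add_le_of_le (le_max_right _ _) (add_le_of_le (le_max_right _ _) (le_max_left _ _)
        (one_le_aleph0.trans (le_max_right _ _))) ?_
      refine le_trans ?_ (le_max_right _ _)
      simp
    simpa using h2
  · rintro b ⟨t, ht⟩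
    exact ⟨⟨t⟩, ht⟩

/-- The least `ε`-isolated subgroup containing `M` and `T`. -/
def isolatedClosure (p : AddGroupSeminorm A) (ε : ℝ) (M : Submodule ℤ A) (T : Set A) :
    Submodule ℤ A :=
  sInf {K | M ≤ K ∧ T ⊆ K ∧ IsolatedModulo p ε K}

theorem isolatedModulo_isolatedClosure (T : Set A) :
    IsolatedModulo p ε (isolatedClosure p ε M T) :=
  IsolatedModulo.sInf fun _ hK => hK.2.2

theorem le_isolatedClosure (T : Set A) : M ≤ isolatedClosure p ε M T :=
  le_sInf fun _ hK => hK.1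

theorem subset_isolatedClosure (T : Set A) : T ⊆ isolatedClosure p ε M T := by
  intro x hx
  exact Submodule.mem_sInf.2 fun K hK => hK.2.1 hx

theorem isolatedClosure_le {T : Set A} {K : Submodule ℤ A} (h₁ : M ≤ K) (h₂ : T ⊆ K)
    (h₃ : IsolatedModulo p ε K) : isolatedClosure p ε M T ≤ K :=
  sInf_le ⟨h₁, h₂, h₃⟩

theorem isolatedClosure_mono {T T' : Set A} (h : T ⊆ T') :
    isolatedClosure p ε M T ≤ isolatedClosure p ε M T' :=
  isolatedClosure_le (le_isolatedClosure _) (h.trans (subset_isolatedClosure _))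
    (isolatedModulo_isolatedClosure _)

/-- A homomorphism to `ℤ` defined on an isolated subgroup extends to any family of elements. -/
theorem IsolatedModulo.exists_extension_family
    (hp : ∀ (n : ℤ) (a : A), p (n • a) = |(n : ℝ)| * p a) (κ : Cardinal.{u}) :
    ∀ (ε : ℝ), 0 < ε → ∀ f : A →ₗ.[ℤ] ℤ, IsolatedModulo p ε f.domain →
      ∀ (ι : Type u), #ι = κ → ∀ e : ι → A, ∃ g ≥ f, ∀ i, e i ∈ g.domain := by
  induction κ using WellFoundedLT.induction with
  | ind κ ih =>
  intro ε hε f hf ι hι e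
  rcases le_or_gt κ ℵ₀ with hκ | hκ
  · have : Countable ι := mk_le_aleph0_iff.1 (hι ▸ hκ)
    rcases isEmpty_or_nonempty ι with h0 | h0
    · exact ⟨f, le_rfl, fun i => h0.elim i⟩
    · obtain ⟨s, hs⟩ := exists_surjective_nat ι
      obtain ⟨g, hg, hge⟩ := hf.exists_extension_nat hp hε (e ∘ s)
      refine ⟨g, hg, fun i => ?_⟩
      obtain ⟨n, rfl⟩ := hs i
      exact hge n
  obtain ⟨σ⟩ : Nonempty (κ.ord.ToType ≃ ι) := Cardinal.eq.1 (by rw [hι]; simp)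
  let d : κ.ord.ToType → A := e ∘ σ
  let cl : Set κ.ord.ToType → Submodule ℤ A := fun I => isolatedClosure p (ε / 2) f.domain (d '' I)
  have hε2 : ε / 2 ≤ ε := by linarith
  -- Taking domains to be closures of initial segments keeps the constant `ε / 2` through unions of
  -- chains.
  let S : Set (A →ₗ.[ℤ] ℤ) := {g | f ≤ g ∧ ∃ I, IsLowerSet I ∧ g.domain = cl I}
  have hfS : f ∈ S := by
    refine ⟨le_rfl, ∅, isLowerSet_empty, le_antisymm (le_isolatedClosure _) ?_⟩
    exact isolatedClosure_le le_rfl (by simp) (hf.mono hε2)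
  obtain ⟨g, hfg, ⟨-, I, hI, hgI⟩, hmax⟩ := zorn_le_nonempty₀ S (by
    intro C hCS hC y hy
    have hd := hC.directedOn
    have hne : C.Nonempty := ⟨y, hy⟩
    refine ⟨LinearPMap.sSup C hd, ⟨(hCS hy).1.trans (LinearPMap.le_sSup hd hy), ?_⟩,
      fun z hz => LinearPMap.le_sSup hd hz⟩
    let J : Set (Set κ.ord.ToType) := {I | IsLowerSet I ∧ ∃ g ∈ C, g.domain = cl I}
    refine ⟨⋃₀ J, isLowerSet_sUnion fun I hI => hI.1, le_antisymm ?_ ?_⟩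
    · intro x hx
      obtain ⟨g, hg, hx⟩ := (LinearPMap.mem_domain_sSup_iff hne hd).1 hx
      obtain ⟨I, hI, hgI⟩ := (hCS hg).2
      rw [hgI] at hx
      exact isolatedClosure_mono (Set.image_mono (Set.subset_sUnion_of_mem
        (show I ∈ J from ⟨hI, g, hg, hgI⟩))) hx
    · refine isolatedClosure_le ((hCS hy).1.trans (LinearPMap.le_sSup hd hy)).1 ?_
        (IsolatedModulo.sSup_domain hne hd fun g hg => ?_)
      · rintro _ ⟨i, ⟨I, ⟨-, g, hg, hgI⟩, hi⟩, rfl⟩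
        refine (LinearPMap.le_sSup hd hg).1 ?_
        rw [hgI]
        exact subset_isolatedClosure _ ⟨i, hi, rfl⟩
      · obtain ⟨I, -, hgI⟩ := (hCS hg).2
        rw [hgI]
        exact isolatedModulo_isolatedClosure _) f hfS
  suffices H : ∀ t, d t ∈ g.domain by
    refine ⟨g, hfg, fun i => ?_⟩
    simpa [d] using H (σ.symm i)
  by_contra! H
  obtain ⟨s, hs⟩ := H
  have hIs : ∀ t ∈ I, t ≤ s := by
    intro t ht
    by_contra! hlt
    refine hs ?_
    rw [hgI]
    exact subset_isolatedClosure _ ⟨s, hI hlt.le ht, rfl⟩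
  -- Proper initial segments of the initial ordinal of `κ` are smaller than `κ`, so the hull of this
  -- one is within reach of the induction hypothesis.
  have hsize : #(Set.Iic s) < κ := by
    rw [← Set.Iio_insert]
    have hlt : #(Set.Iio s) < κ := by simpa using mk_Iio_lt s (by simp)
    exact mk_insert_le.trans_lt (add_lt_of_lt hκ.le hlt (one_lt_aleph0.trans hκ))
  obtain ⟨K, W, w, hMK, hdK, hK, hW, hKw⟩ := hf.exists_hull (fun i : Set.Iic s => d i)
  obtain ⟨g', hgg', hg'⟩ := ih #W (hW.trans_lt (max_lt hsize hκ)) (ε / 2) (half_pos hε) g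
    (hgI ▸ isolatedModulo_isolatedClosure _) W rfl w
  have hclK : cl (Set.Iic s) ≤ K := by
    refine isolatedClosure_le hMK ?_ hK
    rintro _ ⟨i, hi, rfl⟩
    exact hdK ⟨i, hi⟩
  have hcl : cl (Set.Iic s) ≤ g'.domain := fun x hx => by
    obtain ⟨i, hi⟩ := hKw x (hclK hx)
    have := g'.domain.add_mem (hgg'.1 (hfg.1 hi)) (hg' i)
    rwa [sub_add_cancel] at this
  have hgcl : g.domain ≤ cl (Set.Iic s) := by
    rw [hgI]
    exact isolatedClosure_mono (Set.image_mono hIs)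
  -- The domain of `g'` need not be an isolated closure; restricting to `cl (Set.Iic s)` returns to
  -- `S` and contradicts maximality.
  have hdom : (g'.domRestrict (cl (Set.Iic s))).domain = cl (Set.Iic s) := by
    rw [LinearPMap.domRestrict_domain, inf_eq_left]
    exact hcl
  have hle : g ≤ g'.domRestrict (cl (Set.Iic s)) := by
    refine ⟨hgcl.trans hdom.ge, fun x y hxy => ?_⟩
    have hy : (y : A) ∈ g'.domain := hxy ▸ hgg'.1 x.2
    exact (hgg'.2 (y := ⟨y, hy⟩) hxy).trans (LinearPMap.domRestrict_apply rfl).symm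
  have := (hmax ⟨hfg.trans hle, _, isLowerSet_Iic s, hdom⟩ hle).1
  rw [hdom] at this
  exact hs (this (subset_isolatedClosure _ ⟨s, Set.self_mem_Iic, rfl⟩))

/-- An abelian group with a seminorm which is homogeneous, non-trivial, and bounded away from zero
outside its kernel, surjects onto `ℤ`. (Such a group is in fact free modulo the kernel, by a theorem
of Steprāns; no bound on the rank is needed.) -/
theorem exists_surjective_int_of_discrete
    (hp : ∀ (n : ℤ) (a : A), p (n • a) = |(n : ℝ)| * p a) {δ : ℝ} (hδ : 0 < δ)
    (hd : ∀ a, 0 < p a → δ ≤ p a) {a : A} (ha : 0 < p a) :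
    ∃ f : A →+ ℤ, Function.Surjective f := by
  let E : Submodule ℤ A :=
    { carrier := {x | p x = 0}
      zero_mem' := map_zero p
      add_mem' := fun {x y} hx hy => by
        change p x = 0 at hx
        change p y = 0 at hy
        refine le_antisymm ?_ (apply_nonneg p _)
        simpa [hx, hy] using map_add_le_add p x y
      smul_mem' := fun n x hx => by
        change p x = 0 at hx
        change p (n • x) = 0
        rw [hp, hx, mul_zero] }
  have hE : IsolatedModulo p δ E := by
    intro n b m hn hm hlt
    change p m = 0 at hm
    have hnR : (0 : ℝ) < n := by exact_mod_cast hn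
    have h1 : n * p b ≤ p (n • b - m) := by
      have := map_add_le_add p (n • b - m) m
      rwa [sub_add_cancel, hp, abs_of_pos hnR, hm, add_zero] at this
    by_contra hb
    have := hd b (lt_of_le_of_ne (apply_nonneg p b) (Ne.symm hb))
    have := lt_of_mul_lt_mul_left (h1.trans_lt hlt) hnR.le
    linarith
  have haE : a ∉ E := fun h => ha.ne' h
  -- Prescribing the value `1` on the new cyclic factor is what makes the final homomorphism
  -- surjective.
  obtain ⟨g, -, -, ⟨x, hx⟩, ε, hε, hg⟩ :=
    IsolatedModulo.exists_extension (f := (0 : A →ₗ[ℤ] ℤ).toPMap E) hp hE hδ haE 1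
  obtain ⟨k, hgk, hk⟩ := IsolatedModulo.exists_extension_family hp #A ε hε g hg A rfl id
  let f : A →+ ℤ :=
    { toFun := fun a => k ⟨a, hk a⟩
      map_zero' := k.map_zero
      map_add' := fun a b => k.map_add ⟨a, hk a⟩ ⟨b, hk b⟩ }
  have hfx : f x = 1 := by
    rw [← hx]
    exact (hgk.2 rfl).symm
  exact ⟨f, fun n => ⟨n • (x : A), by rw [map_zsmul, hfx]; simp⟩⟩

end Extension

/-! ### Translation lengths in CAT(0) spaces. -/

section TranslationLength

variable {X : Type*} [MetricSpace X]

/-- In a CAT(0) space the points halfway along two sides of an isosceles triangle, adjacent to the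
apex, are at most half of the base apart. -/
theorem IsCAT0.dist_midpoints_le (hX : IsCAT0 X) {x y z : X} (h : dist x y = dist y z)
    {l : ℝ} {α β : ℝ → X} (hα : IsGeodesic x y l α) (hβ : IsGeodesic y z l β) :
    dist (α (l / 2)) (β (l / 2)) ≤ dist x z / 2 := by
  obtain ⟨k, γ, hγ⟩ := hX.1 z x
  obtain ⟨hl, hα0, hαl, hαd⟩ := hα
  obtain ⟨-, hβ0, hβl, hβd⟩ := hβ
  have hxy : dist x y = l := by
    rw [← hα0, ← hαl, hαd 0 ⟨le_rfl, hl⟩ l ⟨hl, le_rfl⟩, zero_sub, abs_neg, abs_of_nonneg hl]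
  have hyz : dist y z = l := h ▸ hxy
  set c := dist x z with hc
  have hc0 : 0 ≤ c := dist_nonneg
  have hcl : c ≤ 2 * l := by
    have := dist_triangle x y z
    linarith
  have hs : 0 ≤ l ^ 2 - (c / 2) ^ 2 := by nlinarith
  let P : Fin 3 → X := ![x, y, z]
  let S : Fin 3 → Set X := ![α '' Set.Icc 0 l, β '' Set.Icc 0 l, γ '' Set.Icc 0 k]
  let q : Fin 3 → EuclideanSpace ℝ (Fin 2) :=
    ![!₂[-(c / 2), 0], !₂[0, √(l ^ 2 - (c / 2) ^ 2)], !₂[c / 2, 0]]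
  have hT : IsGeodesicTriangle P S := by
    intro i
    fin_cases i
    · exact ⟨l, α, ⟨hl, hα0, hαl, hαd⟩, rfl⟩
    · exact ⟨l, β, ⟨hl, hβ0, hβl, hβd⟩, rfl⟩
    · exact ⟨k, γ, hγ, rfl⟩
  have h01 : dist (q 0) (q 1) = l := by
    simp [q, EuclideanSpace.dist_eq, Fin.sum_univ_two, Real.dist_eq, sq_abs, Real.sq_sqrt hs,
      Real.sqrt_sq hl]
  have h12 : dist (q 1) (q 2) = l := by
    simp [q, EuclideanSpace.dist_eq, Fin.sum_univ_two, Real.dist_eq, sq_abs, Real.sq_sqrt hs,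
      Real.sqrt_sq hl]
  have h02 : dist (q 0) (q 2) = c := by
    have : -(c / 2) - c / 2 = -c := by ring
    simp [q, EuclideanSpace.dist_eq, Fin.sum_univ_two, Real.dist_eq, sq_abs, this,
      Real.sqrt_sq hc0]
  have hq : IsComparisonTriangle P q := by
    intro i j
    fin_cases i <;> fin_cases j <;>
      simp [P, dist_comm, h01, h12, h02, hxy, hyz, dist_comm (q 1) (q 0), ← hc]
  have hmem : l / 2 ∈ Set.Icc 0 l := ⟨by positivity, by linarith⟩
  have hd : |l / 2| = l / 2 := abs_of_nonneg hmem.1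
  have key := hX.2 P S hT q hq 0 1 (α (l / 2)) ⟨_, hmem, rfl⟩ (β (l / 2)) ⟨_, hmem, rfl⟩
    (midpoint ℝ (q 0) (q 1)) (midpoint ℝ (q 1) (q 2))
    ⟨midpoint_mem_segment _ _, by
      change _ = dist (α (l / 2)) x
      rw [dist_midpoint_left, h01, ← hα0, hαd _ hmem _ ⟨le_rfl, hl⟩, sub_zero, hd]
      simp
      ring⟩
    ⟨midpoint_mem_segment _ _, by
      change _ = dist (β (l / 2)) y
      rw [dist_midpoint_left, h12, ← hβ0, hβd _ hmem _ ⟨le_rfl, hl⟩, sub_zero, hd]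
      simp
      ring⟩
  refine key.trans (le_of_eq ?_)
  rw [← h02, dist_eq_norm, dist_eq_norm, midpoint_eq_smul_add, midpoint_eq_smul_add, ← smul_sub,
    norm_smul, add_comm (q 0), add_sub_add_left_eq_sub]
  simp
  ring

theorem translationLength_le (f : X ≃ᵢ X) (x : X) : translationLength f ≤ dist (f x) x :=
  ciInf_le ⟨0, by rintro _ ⟨y, rfl⟩; exact dist_nonneg⟩ x

theorem translationLength_nonneg (f : X ≃ᵢ X) : 0 ≤ translationLength f :=
  Real.iInf_nonneg fun _ => dist_nonneg

theorem translationLength_one : translationLength (1 : X ≃ᵢ X) = 0 := by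
  refine le_antisymm ?_ (translationLength_nonneg _)
  rcases isEmpty_or_nonempty X with h | ⟨⟨x⟩⟩
  · simp [translationLength]
  · simpa using translationLength_le (1 : X ≃ᵢ X) x

theorem translationLength_inv (f : X ≃ᵢ X) : translationLength f⁻¹ = translationLength f := by
  refine (f.toEquiv.iInf_congr fun x => ?_).symm
  change dist (f⁻¹ (f x)) (f x) = _
  rw [← IsometryEquiv.mul_apply, inv_mul_cancel, dist_comm]
  rfl

theorem dist_pow_apply_le (f : X ≃ᵢ X) (x : X) (n : ℕ) : dist ((f ^ n) x) x ≤ n * dist (f x) x := by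
  induction n with
  | zero => simp
  | succ n ih =>
    rw [pow_succ, IsometryEquiv.mul_apply]
    calc _ ≤ dist ((f ^ n) (f x)) ((f ^ n) x) + dist ((f ^ n) x) x := dist_triangle _ _ _
      _ ≤ dist (f x) x + n * dist (f x) x := by rw [(f ^ n).dist_eq]; gcongr
      _ = _ := by push_cast; ring

/-- `f` carries the midpoint of a geodesic from `x` to `f x` to that of its image, and these are at
most half of `dist x (f (f x))` apart. -/
theorem IsCAT0.two_mul_translationLength_le (hX : IsCAT0 X) (f : X ≃ᵢ X) :
    2 * translationLength f ≤ translationLength (f ^ 2) := by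
  rcases isEmpty_or_nonempty X with h | h
  · simp [translationLength]
  · refine le_ciInf fun x => ?_
    obtain ⟨l, α, hα⟩ := hX.1 x (f x)
    have hfα : IsGeodesic (f x) (f (f x)) l (f ∘ α) := by
      obtain ⟨h0, h1, h2, h3⟩ := hα
      exact ⟨h0, congrArg f h1, congrArg f h2, fun t ht t' ht' => by
        rw [← h3 t ht t' ht']; exact f.dist_eq _ _⟩
    have h1 := hX.dist_midpoints_le (f.dist_eq x (f x)).symm hα hfα
    have h2 := translationLength_le f (α (l / 2))
    rw [dist_comm] at h2
    have h3 : dist ((f ^ 2) x) x = dist x (f (f x)) := by rw [dist_comm, pow_two]; rfl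
    rw [h3]
    change dist (α (l / 2)) (f (α (l / 2))) ≤ _ at h1
    linarith

theorem IsCAT0.two_pow_mul_translationLength_le (hX : IsCAT0 X) (f : X ≃ᵢ X) (k : ℕ) :
    2 ^ k * translationLength f ≤ translationLength (f ^ 2 ^ k) := by
  induction k with
  | zero => simp
  | succ k ih =>
    have := hX.two_mul_translationLength_le (f ^ 2 ^ k)
    rw [← pow_mul, ← pow_succ] at this
    calc _ = 2 * (2 ^ k * translationLength f) := by ring
      _ ≤ _ := by linarith

/-- The translation length is subadditive on commuting semi-simple isometries of a CAT(0) space. -/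
theorem IsCAT0.translationLength_mul_le (hX : IsCAT0 X) {f g : X ≃ᵢ X} (hfg : Commute f g)
    (hf : IsSemisimpleIsometry f) (hg : IsSemisimpleIsometry g) :
    translationLength (f * g) ≤ translationLength f + translationLength g := by
  obtain ⟨x, hx⟩ := hf
  obtain ⟨y, hy⟩ := hg
  change dist (f x) x = _ at hx
  change dist (g y) y = _ at hy
  -- Moving between the minsets of `f` and `g` costs `2 * dist x y` whatever the power, so a
  -- positive defect would outgrow it.
  have key : ∀ k : ℕ, 2 ^ k * (translationLength (f * g) -
      (translationLength f + translationLength g)) ≤ 2 * dist x y := by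
    intro k
    have h1 := hX.two_pow_mul_translationLength_le (f * g) k
    have h2 := translationLength_le ((f * g) ^ 2 ^ k) x
    rw [hfg.mul_pow, IsometryEquiv.mul_apply] at h2
    have h3 := dist_triangle ((f ^ 2 ^ k) ((g ^ 2 ^ k) x)) ((f ^ 2 ^ k) x) x
    rw [(f ^ 2 ^ k).dist_eq] at h3
    have h4 := dist_triangle4 ((g ^ 2 ^ k) x) ((g ^ 2 ^ k) y) y x
    rw [(g ^ 2 ^ k).dist_eq, dist_comm y x] at h4
    have h5 := dist_pow_apply_le f x (2 ^ k)
    have h6 := dist_pow_apply_le g y (2 ^ k)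
    rw [hfg.mul_pow] at h1
    rw [hx] at h5
    rw [hy] at h6
    push_cast at h5 h6
    linarith
  by_contra! hlt
  obtain ⟨k, hk⟩ := pow_unbounded_of_one_lt (2 * dist x y / (translationLength (f * g) -
      (translationLength f + translationLength g))) one_lt_two
  rw [div_lt_iff₀ (by linarith)] at hk
  exact (key k).not_gt hk

end TranslationLength

/-! ### Homogeneity from doubling. -/

section Homogeneity

/-- A subadditive even function on an abelian group which doubles under multiplication by two is
homogeneous. -/
theorem map_zsmul_of_map_two_nsmul {A : Type*} [AddCommGroup A] (p : AddGroupSeminorm A)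
    (h2 : ∀ a, 2 * p a ≤ p (2 • a)) (n : ℤ) (a : A) : p (n • a) = |(n : ℝ)| * p a := by
  have hle : ∀ n : ℕ, p (n • a) ≤ n * p a := fun n => by
    induction n with
    | zero => simp
    | succ n ih =>
      rw [succ_nsmul]
      push_cast
      linarith [map_add_le_add p (n • a) a]
  have hpow : ∀ k : ℕ, 2 ^ k * p a ≤ p (2 ^ k • a) := fun k => by
    induction k with
    | zero => simp
    | succ k ih =>
      have := h2 (2 ^ k • a)
      rw [← mul_nsmul', ← pow_succ'] at this
      calc _ = 2 * (2 ^ k * p a) := by ring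
        _ ≤ _ := by linarith
  have hnat : ∀ n : ℕ, p (n • a) = n * p a := fun n => by
    refine le_antisymm (hle n) ?_
    -- Homogeneity at `2 ^ n` passes down to `n`: the complement `2 ^ n - n` contributes at most its
    -- share.
    have hn : n ≤ 2 ^ n := Nat.lt_two_pow_self.le
    have h1 := map_add_le_add p (n • a) ((2 ^ n - n) • a)
    rw [← add_nsmul, Nat.add_sub_cancel' hn] at h1
    have h3 := hle (2 ^ n - n)
    have h4 := hpow n
    push_cast [hn] at h3
    linarith
  obtain ⟨m, rfl | rfl⟩ := n.eq_nat_or_neg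
  · simp [hnat]
  · simp [hnat]

end Homogeneity

/-! ### The theorem: translation length as a discrete seminorm. -/

theorem theorem4p1 {A : Type*} [CommGroup A] {X : Type*} [MetricSpace X] [CompleteSpace X]
    (hX : IsCAT0 X) (hrank : flatRank X < ⊤)
    (φ : A →* (X ≃ᵢ X)) (hφ : IsSemisimpleAction φ)
    (hinf : 0 < infPosTranslationLength φ)
    (hA : ¬ ∃ N : Subgroup A, Nonempty ((A ⧸ N) ≃* Multiplicative ℤ)) :
    ∀ f ∈ φ.range, IsEllipticIsometry f := by
  rintro _ ⟨a, rfl⟩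
  refine ⟨?_, hφ a⟩
  by_contra ha
  let p : AddGroupSeminorm (Additive A) :=
    { toFun := fun x => translationLength (φ x.toMul)
      map_zero' := by simp [translationLength_one]
      add_le' := fun x y => by
        rw [toMul_add, map_mul]
        exact hX.translationLength_mul_le ((Commute.all _ _).map φ) (hφ _) (hφ _)
      neg' := fun x => by rw [toMul_neg, map_inv, translationLength_inv] }
  have hp : ∀ (n : ℤ) (x : Additive A), p (n • x) = |(n : ℝ)| * p x :=
    map_zsmul_of_map_two_nsmul p fun x => by
      change 2 * translationLength (φ x.toMul) ≤ translationLength (φ (2 • x).toMul)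
      rw [toMul_nsmul, map_pow]
      exact hX.two_mul_translationLength_le _
  -- A real `δ` strictly below the infimum, which could a priori be infinite.
  obtain ⟨δ, hδ, hδ'⟩ := EReal.lt_iff_exists_real_btwn.1 hinf
  have hd : ∀ x, 0 < p x → δ ≤ p x := fun x hx =>
    EReal.coe_le_coe_iff.1 (hδ'.le.trans (sInf_le ⟨x.toMul, hx, rfl⟩))
  obtain ⟨f, hf⟩ := exists_surjective_int_of_discrete hp (EReal.coe_pos.1 hδ) hd
    (a := Additive.ofMul a) (lt_of_le_of_ne (translationLength_nonneg _) (Ne.symm ha))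
  refine hA ⟨_, ⟨QuotientGroup.quotientKerEquivOfSurjective
    (AddMonoidHom.toMultiplicativeRight f) ?_⟩⟩
  exact hf
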